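/- Let $(d_k)_{k\ge 1}$ be a nondecreasing sequence of positive real numbers with $d_k=O(\sqrt{k})$ as $k\to\infty$, and let $(\varphi_n)_{n\ge 1}$ be any orthonormal sequence in the real space $L_2([0,1])$ (with Lebesgue measure). Then there are indices $n_1<n_2<\cdots$ such that for every $f\in \mathrm{Lip}_1$, i.e. every $f:[0,1]\to\mathbb{R}$ with $|f(x)-f(y)|\le K|x-y|$ on $[0,1]$ for some constant $K$, the series $$\sum_{k=1}^{\infty} d_k\, C_{n_k}(f)\,\varphi_{n_k}(x),\qquad C_n(f)=\int_0^1 f(t)\varphi_n(t)\,dt,$$ converges unconditionally a.e. on $[0,1]$; that is, for every permutation $\sigma$ of $\{1,2,\dots\}$ the rearranged series $\sum_{k=1}^{\infty} d_{\sigma(k)}\, C_{n_{\sigma(k)}}(f)\,\varphi_{n_{\sigma(k)}}(x)$ converges for almost every $x\in[0,1]$ (the exceptional null set may depend on $f$ and $\sigma$). The indices $n_k$ depend only on $(d_k)$ and $(\varphi_n)$, not on $f$. -/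

import Mathlib

open MeasureTheory Filter Topology

/-- Lebesgue measure on `[0,1]`. -/
noncomputable abbrev lebesgueUnit : Measure ℝ := volume.restrict (Set.Icc (0 : ℝ) 1)

/-- The real space `L₂([0,1])`. -/
noncomputable abbrev L2Unit : Type := Lp ℝ 2 lebesgueUnit

/-- The class `Lip₁` of Lipschitz functions on `[0,1]`. Only the values of `f` on `[0,1]` matter. -/
def IsLipOne (f : ℝ → ℝ) : Prop :=
  ∃ K : NNReal, LipschitzOnWith K f (Set.Icc (0 : ℝ) 1)

/-- The Fourier coefficient `C(f) = ∫₀¹ f(x) φ(x) dx` of `f` with respect to `φ`. -/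
noncomputable def onsCoeff (φ : L2Unit) (f : ℝ → ℝ) : ℝ :=
  ∫ x in Set.Icc (0 : ℝ) 1, f x * φ x

/-- The series `∑ uₖ` converges unconditionally `μ`-a.e.: every rearrangement of it converges
at `μ`-almost every point. As usual for series of functions, the exceptional null set
may depend on the rearrangement. -/
def UnconditionallyConvergesAE (μ : Measure ℝ) (u : ℕ → ℝ → ℝ) : Prop :=
  ∀ σ : Equiv.Perm ℕ, ∀ᵐ x ∂μ, ∃ s : ℝ,
    Tendsto (fun N : ℕ => ∑ k ∈ Finset.range N, u (σ k) x) atTop (𝓝 s)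

/-! The coefficients `onsCoeff (φ n) f` tend to zero uniformly over `f` with `K + |f 0|` bounded:
such `f` are uniformly close to step functions of a fixed mesh, and by Bessel `φ n` has vanishing
integral over each of the finitely many cells. A sparse subsequence therefore brings the `k`-th
weighted coefficient below a multiple of `2⁻ᵏ` for all Lipschitz `f` at once. Since `∑ 2⁻ᵏ |φ (n
k)|` is finite a.e., the series converges absolutely a.e., so every rearrangement converges. -/

instance isProbabilityMeasure_lebesgueUnit : IsProbabilityMeasure lebesgueUnit :=
  ⟨by simp [lebesgueUnit]⟩

/-- Bessel: an orthonormal sequence tends weakly to zero. -/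
theorem Orthonormal.tendsto_inner_zero {E : Type*} [NormedAddCommGroup E]
    [InnerProductSpace ℝ E] {v : ℕ → E} (hv : Orthonormal ℝ v) (x : E) :
    Tendsto (fun n => inner ℝ x (v n)) atTop (𝓝 0) := by
  have h := (hv.inner_products_summable x).tendsto_atTop_zero
  rw [tendsto_zero_iff_norm_tendsto_zero]
  have h2 := h.sqrt
  simpa [real_inner_comm, Real.sqrt_sq_eq_abs] using h2

theorem lintegral_enorm_le_one {g : L2Unit} (hg : ‖g‖ = 1) :
    ∫⁻ x, ‖g x‖ₑ ∂lebesgueUnit ≤ 1 := by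
  rw [← eLpNorm_one_eq_lintegral_enorm]
  refine (eLpNorm_le_eLpNorm_of_exponent_le (q := 2) (by norm_num)
    (Lp.aestronglyMeasurable g)).trans ?_
  rw [← Lp.enorm_def, ← ofReal_norm, hg, ENNReal.ofReal_one]

theorem integrable_l2Unit (g : L2Unit) : Integrable g lebesgueUnit :=
  (Lp.memLp g).integrable (by norm_num)

theorem integral_abs_le_one {g : L2Unit} (hg : ‖g‖ = 1) :
    ∫ x, |g x| ∂lebesgueUnit ≤ 1 := by
  have h := integral_norm_eq_lintegral_enorm (Lp.aestronglyMeasurable g)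
  simp only [Real.norm_eq_abs] at h
  rw [h]
  exact ENNReal.toReal_le_of_le_ofReal zero_le_one (by simpa using lintegral_enorm_le_one hg)

theorem tendsto_setIntegral_orthonormal {φ : ℕ → L2Unit} (hφ : Orthonormal ℝ φ)
    {s : Set ℝ} (hs : MeasurableSet s) :
    Tendsto (fun n => ∫ x in s, φ n x ∂lebesgueUnit) atTop (𝓝 0) := by
  refine (hφ.tendsto_inner_zero
    (indicatorConstLp 2 hs (measure_ne_top lebesgueUnit s) (1 : ℝ))).congr fun n => ?_
  rw [L2.inner_indicatorConstLp_one]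

theorem tendsto_intervalIntegral_orthonormal {φ : ℕ → L2Unit} (hφ : Orthonormal ℝ φ)
    {a b : ℝ} (ha : 0 ≤ a) (hab : a ≤ b) (hb : b ≤ 1) :
    Tendsto (fun n => ∫ x in a..b, φ n x) atTop (𝓝 0) := by
  refine (tendsto_setIntegral_orthonormal hφ (s := Set.Ioc a b) measurableSet_Ioc).congr
    fun n => ?_
  rw [intervalIntegral.integral_of_le hab, Measure.restrict_restrict_of_subset]
  exact fun x hx => ⟨ha.trans hx.1.le, hx.2.trans hb⟩

theorem intervalIntegrable_of_integrable_unit {g : ℝ → ℝ} (hg : Integrable g lebesgueUnit)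
    {a b : ℝ} (ha : 0 ≤ a) (hab : a ≤ b) (hb : b ≤ 1) :
    IntervalIntegrable g volume a b := by
  rw [intervalIntegrable_iff_integrableOn_Ioc_of_le hab]
  exact IntegrableOn.mono_set (t := Set.Icc 0 1) hg
    fun x hx => ⟨ha.trans hx.1.le, hx.2.trans hb⟩

/-- On a short interval a Lipschitz function is nearly constant. -/
theorem abs_intervalIntegral_mul_le {f g : ℝ → ℝ} {K : NNReal}
    (hf : LipschitzOnWith K f (Set.Icc (0 : ℝ) 1)) (hg : Integrable g lebesgueUnit)
    {a b : ℝ} (ha : 0 ≤ a) (hab : a ≤ b) (hb : b ≤ 1) :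
    |∫ x in a..b, f x * g x| ≤
      K * (b - a) * (∫ x in a..b, |g x|) + (K + |f 0|) * |∫ x in a..b, g x| := by
  have hsub : Set.uIcc a b ⊆ Set.Icc 0 1 := by
    rw [Set.uIcc_of_le hab]; exact Set.Icc_subset_Icc ha hb
  have hgi := intervalIntegrable_of_integrable_unit hg ha hab hb
  have hga : IntervalIntegrable (fun x => |g x|) volume a b := hgi.abs
  have hfg : IntervalIntegrable (fun x => f x * g x) volume a b :=
    hgi.continuousOn_mul (hf.continuousOn.mono hsub)
  have ha1 : a ∈ Set.Icc (0 : ℝ) 1 := ⟨ha, hab.trans hb⟩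
  have hcst : IntervalIntegrable (fun x => f a * g x) volume a b := hgi.const_mul _
  -- Freeze `f` at the left endpoint; the frozen part sees only the integral of `g`.
  have hsplit : ∫ x in a..b, f x * g x =
      (∫ x in a..b, (f x * g x - f a * g x)) + f a * ∫ x in a..b, g x := by
    rw [intervalIntegral.integral_sub hfg hcst, intervalIntegral.integral_const_mul]
    ring
  have h1 : |∫ x in a..b, (f x * g x - f a * g x)| ≤ K * (b - a) * ∫ x in a..b, |g x| := by
    rw [← intervalIntegral.integral_const_mul, ← Real.norm_eq_abs]
    refine intervalIntegral.norm_integral_le_of_norm_le hab (ae_of_all _ fun x hx => ?_)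
      (hga.const_mul _)
    rw [← sub_mul, norm_mul, Real.norm_eq_abs (g x)]
    refine mul_le_mul_of_nonneg_right ?_ (abs_nonneg _)
    have h := hf.dist_le_mul x ⟨ha.trans hx.1.le, hx.2.trans hb⟩ a ha1
    rw [Real.dist_eq, Real.dist_eq, abs_of_pos (sub_pos.2 hx.1)] at h
    exact h.trans (mul_le_mul_of_nonneg_left (by linarith [hx.2]) K.2)
  -- Going through `f 0` gives a bound independent of the interval.
  have h2 : |f a| ≤ K + |f 0| := by
    have h := hf.dist_le_mul a ha1 0 ⟨le_rfl, zero_le_one⟩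
    rw [Real.dist_eq, Real.dist_eq, sub_zero, abs_of_nonneg ha] at h
    have h3 := abs_sub_abs_le_abs_sub (f a) (f 0)
    have h4 : (K : ℝ) * a ≤ K := mul_le_of_le_one_right K.2 ha1.2
    linarith
  rw [hsplit]
  refine (abs_add_le _ _).trans (add_le_add h1 ?_)
  rw [abs_mul]
  exact mul_le_mul_of_nonneg_right h2 (abs_nonneg _)

/-- Comparison with the step functions of mesh `1 / M`. -/
theorem abs_onsCoeff_le {f : ℝ → ℝ} {K : NNReal} (hf : LipschitzOnWith K f (Set.Icc (0 : ℝ) 1))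
    {g : L2Unit} (hg : ‖g‖ = 1) {M : ℕ} (hM : 0 < M) :
    |onsCoeff g f| ≤ (K + |f 0|) *
      (1 / M + ∑ i ∈ Finset.range M, |∫ x in (i / M : ℝ)..((i + 1 : ℕ) / M : ℝ), g x|) := by
  have hM' : (0 : ℝ) < M := by exact_mod_cast hM
  have hgI := integrable_l2Unit g
  have h0 (i : ℕ) : (0 : ℝ) ≤ i / M := by positivity
  have hle (i : ℕ) : (i / M : ℝ) ≤ ((i + 1 : ℕ) / M : ℝ) := by gcongr; simp
  have h1 {i : ℕ} (hi : i < M) : ((i + 1 : ℕ) / M : ℝ) ≤ 1 := by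
    rw [div_le_one hM']; exact_mod_cast hi
  have hg1 {i : ℕ} (hi : i < M) := intervalIntegrable_of_integrable_unit hgI (h0 i) (hle i) (h1 hi)
  have hfg {i : ℕ} (hi : i < M) : IntervalIntegrable (fun x => f x * g x) volume
      (i / M : ℝ) ((i + 1 : ℕ) / M : ℝ) := by
    refine (hg1 hi).continuousOn_mul (hf.continuousOn.mono ?_)
    rw [Set.uIcc_of_le (hle i)]
    exact Set.Icc_subset_Icc (h0 i) (h1 hi)
  have hsum : onsCoeff g f =
      ∑ i ∈ Finset.range M, ∫ x in (i / M : ℝ)..((i + 1 : ℕ) / M : ℝ), f x * g x := by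
    rw [intervalIntegral.sum_integral_adjacent_intervals (a := fun i : ℕ => (i / M : ℝ))
      fun i hi => hfg hi]
    rw [onsCoeff, integral_Icc_eq_integral_Ioc, ← intervalIntegral.integral_of_le zero_le_one]
    simp [hM'.ne']
  -- Hence the oscillation errors over all cells total at most `K / M`.
  have habs : ∑ i ∈ Finset.range M, ∫ x in (i / M : ℝ)..((i + 1 : ℕ) / M : ℝ), |g x| ≤ 1 := by
    rw [intervalIntegral.sum_integral_adjacent_intervals (a := fun i : ℕ => (i / M : ℝ))
      fun i hi => (hg1 hi).abs]
    have h := integral_abs_le_one hg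
    rw [integral_Icc_eq_integral_Ioc, ← intervalIntegral.integral_of_le zero_le_one] at h
    simpa [hM'.ne'] using h
  rw [hsum]
  calc |∑ i ∈ Finset.range M, ∫ x in (i / M : ℝ)..((i + 1 : ℕ) / M : ℝ), f x * g x|
      ≤ ∑ i ∈ Finset.range M, |∫ x in (i / M : ℝ)..((i + 1 : ℕ) / M : ℝ), f x * g x| :=
        Finset.abs_sum_le_sum_abs _ _
    _ ≤ ∑ i ∈ Finset.range M, (K * (1 / M) * (∫ x in (i / M : ℝ)..((i + 1 : ℕ) / M : ℝ), |g x|) +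
          (K + |f 0|) * |∫ x in (i / M : ℝ)..((i + 1 : ℕ) / M : ℝ), g x|) := by
        refine Finset.sum_le_sum fun i hi => ?_
        have h := abs_intervalIntegral_mul_le hf hgI (h0 i) (hle i) (h1 (Finset.mem_range.1 hi))
        have hd : (((i + 1 : ℕ) / M : ℝ) - i / M) = 1 / M := by push_cast; ring
        rwa [hd] at h
    _ ≤ _ := by
        rw [Finset.sum_add_distrib, ← Finset.mul_sum, ← Finset.mul_sum, mul_add]
        refine add_le_add_left ((mul_le_of_le_one_right ?_ habs).trans ?_) _
        · positivity
        · exact mul_le_mul_of_nonneg_right (by linarith [abs_nonneg (f 0)]) (by positivity)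

/-- The coefficients of an orthonormal sequence tend to zero uniformly over bounded sets of
Lipschitz functions. -/
theorem eventually_abs_onsCoeff_le {φ : ℕ → L2Unit} (hφ : Orthonormal ℝ φ) {ε : ℝ} (hε : 0 < ε) :
    ∀ᶠ n in atTop, ∀ (f : ℝ → ℝ) (K : NNReal), LipschitzOnWith K f (Set.Icc (0 : ℝ) 1) →
      |onsCoeff (φ n) f| ≤ (K + |f 0|) * ε := by
  -- The mesh depends on `ε` alone, so only finitely many integrals must become small; each half of
  -- `ε` pays for one term.
  obtain ⟨m, hm⟩ := exists_nat_one_div_lt (half_pos hε)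
  have hlim : Tendsto (fun n => ∑ i ∈ Finset.range (m + 1),
      |∫ x in (i / (m + 1 : ℕ) : ℝ)..((i + 1 : ℕ) / (m + 1 : ℕ) : ℝ), φ n x|) atTop (𝓝 0) := by
    rw [← Finset.sum_const_zero (s := Finset.range (m + 1))]
    refine tendsto_finsetSum _ fun i hi => ?_
    rw [← abs_zero]
    refine (tendsto_intervalIntegral_orthonormal hφ (by positivity) ?_ ?_).abs
    · gcongr; simp
    rw [div_le_one (Nat.cast_pos.2 m.succ_pos)]
    exact_mod_cast Finset.mem_range.1 hi
  filter_upwards [hlim.eventually (gt_mem_nhds (half_pos hε))] with n hn f K hf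
  refine (abs_onsCoeff_le hf (hφ.1 n) m.succ_pos).trans ?_
  gcongr
  push_cast at hn hm ⊢
  linarith

/-- Each `L¹` norm is at most the `L²` norm `1`, so by Tonelli the sum has finite integral and is
finite a.e. -/
theorem ae_summable_geometric_mul_abs {ψ : ℕ → L2Unit} (hψ : ∀ k, ‖ψ k‖ = 1) :
    ∀ᵐ x ∂lebesgueUnit, Summable fun k => (1 / 2 : ℝ) ^ k * |ψ k x| := by
  have hmeas (k : ℕ) : AEMeasurable (fun x => ENNReal.ofReal ((1 / 2) ^ k) * ‖ψ k x‖ₑ)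
      lebesgueUnit := (Lp.aestronglyMeasurable (ψ k)).enorm.const_mul _
  have hfin : ∫⁻ x, ∑' k, ENNReal.ofReal ((1 / 2) ^ k) * ‖ψ k x‖ₑ ∂lebesgueUnit ≠ ⊤ := by
    rw [lintegral_tsum hmeas]
    refine ne_top_of_le_ne_top summable_geometric_two.tsum_ofReal_ne_top
      (ENNReal.tsum_le_tsum fun k => ?_)
    rw [lintegral_const_mul' _ _ ENNReal.ofReal_ne_top]
    exact mul_le_of_le_one_right' (lintegral_enorm_le_one (hψ k))
  filter_upwards [ae_lt_top' (AEMeasurable.tsum hmeas) hfin] with x hx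
  refine (ENNReal.summable_toReal hx.ne).congr fun k => ?_
  rw [ENNReal.toReal_mul, ENNReal.toReal_ofReal (by positivity), toReal_enorm, Real.norm_eq_abs]

theorem theorem5 (d : ℕ → ℝ) (hd_mono : Monotone d) (hd_pos : ∀ k, 0 < d k)
    (hd_bigO : d =O[atTop] (fun n : ℕ => Real.sqrt (n : ℝ)))
    (φ : ℕ → L2Unit) (hφ : Orthonormal ℝ φ) :
    ∃ n : ℕ → ℕ, StrictMono n ∧
      ∀ f : ℝ → ℝ, IsLipOne f →
        UnconditionallyConvergesAE lebesgueUnit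
          (fun k x => d k * onsCoeff (φ (n k)) f * φ (n k) x) := by
  -- Dividing the tolerance by `d k` absorbs the weight, leaving `2⁻ᵏ`.
  obtain ⟨n, hn, hcoeff⟩ := extraction_forall_of_eventually fun k =>
    eventually_abs_onsCoeff_le hφ (ε := (1 / 2) ^ k / d k) (div_pos (by positivity) (hd_pos k))
  refine ⟨n, hn, fun f ⟨K, hf⟩ σ => ?_⟩
  -- This null set depends on neither `f` nor `σ`.
  filter_upwards [ae_summable_geometric_mul_abs fun k => hφ.1 (n k)] with x hx
  have hsum : Summable fun k => d k * onsCoeff (φ (n k)) f * φ (n k) x := by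
    refine Summable.of_norm_bounded (hx.mul_left (K + |f 0|)) fun k => ?_
    rw [norm_mul, norm_mul, Real.norm_eq_abs, Real.norm_eq_abs, Real.norm_eq_abs,
      abs_of_pos (hd_pos k), ← mul_assoc]
    refine mul_le_mul_of_nonneg_right ?_ (abs_nonneg _)
    calc d k * |onsCoeff (φ (n k)) f| ≤ d k * ((K + |f 0|) * ((1 / 2) ^ k / d k)) :=
          mul_le_mul_of_nonneg_left (hcoeff k f K hf) (hd_pos k).le
      _ = (K + |f 0|) * (1 / 2) ^ k := by field_simp [(hd_pos k).ne']
  exact ⟨_, ((Equiv.summable_iff σ).2 hsum).hasSum.tendsto_sum_nat⟩
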